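/- **Model.** There are $m\ge 2$ types $[m]=\{0,\dots,m-1\}$ and a continuum of agents of total mass $n>0$. A type-$i$ agent reporting $k$ is paid $\mathrm{pay}(k)$ and brings the principal $\mathrm{val}(i,k)\in\mathbb R$. If a report $k$ is audited, which costs the principal $\lambda\ge 0$, a misreporting agent ($i\ne k$) pays her $\mathrm{pen}(k)$; put $\mathrm{pen}(i,k)=\mathbf 1[i\neq k]\,\mathrm{pen}(k)$. Assume $0<\mathrm{pay}(0)<\dots<\mathrm{pay}(m-1)$; $\mathrm{val}(i,k)\ge \mathrm{val}(i,l)$ for $i\le k\le l$; $\mathrm{pen}(k)\ge\mathrm{pay}(k)$ and $\lambda\le\mathrm{pen}(k)$ for all $k$. Under an audit vector $p\in[0,1]^m$ ($p_k$ is the probability of auditing a report $k$) the set $Eqi(p)$ consists of the row-stochastic matrices $Q$ such that $Q_{i,k}>0$ implies $k\in\arg\max_l\,(\mathrm{pay}(l)-p_l\,\mathrm{pen}(i,l))$. For a prior $q\in\Delta_m$ put $$V_\lambda(p;q)=\min_{Q\in Eqi(p)}\; n\sum_{i,k}q_iQ_{i,k}\big(\mathrm{val}(i,k)-\mathrm{pay}(k)+p_k\,\mathrm{pen}(i,k)-\lambda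 p_k\big).$$ **Regret.** Nature fixes priors $\vec q=(q^0,\dots,q^{T-1})\in\Delta_m^T$, unknown to the principal. In round $t$ the principal's algorithm $\mathcal A$ randomly plays an audit vector $p^t$, based on its past plays and utilities, and then observes only the utility $v^t=V_\lambda(p^t;q^t)$. The multi-agent Stackelberg regret is $$Reg_T(\mathcal A)=\sup_{\vec q}\Big(\sup_{p\in[0,1]^m}\sum_{t<T}V_\lambda(p;q^t)-\mathbb E_{\mathcal A}\Big[\sum_{t<T}V_\lambda(p^t;q^t)\Big]\Big).$$ **Algorithm.** Put $\mathrm{pay}(-1)=0$, $\gamma=\min_k(\mathrm{pay}(k)-\mathrm{pay}(k-1))$ and $\rho_k(u)=(\mathrm{pay}(k)-u)/\mathrm{pen}(k)$. For $u\in\mathbb R$, $\kappa\in[m]$ and $\varepsilon>0$ let $\mathrm{equal}(u,\kappa,\varepsilon)$ be the vector with $k$-th entry $0$ if $\mathrm{pay}(k)<u$; otherwise $\rho_\kappa(u)$ if $k=\kappa$, and $\rho_k(u-\varepsilon)$ if $k\ne\kappa$. The critical audit vectors are $\mathrm{equal}^+(\iota,\kappa,\varepsilon)=\mathrm{equal}(\mathrm{pay}(\iota-1)+\varepsilon,\kappa,\varepsilon)$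 and $\mathrm{equal}^-(\iota,\kappa,\varepsilon)=\mathrm{equal}(\mathrm{pay}(\iota)-\varepsilon,\kappa,\varepsilon)$. Let $B=\max_{i,k}\big(|\mathrm{val}(i,k)|+\mathrm{pay}(k)+\mathrm{pen}(k)\big)$, $L=nB$, $\eta=\sqrt{\log(2m^2)/(2m^2T)}$, $\varepsilon_t=2^{-t}\gamma/3$ and $\Sigma=[m]\times[m]\times\{+,-\}$. Start with the scores $s^0_\sigma=0$ ($\sigma\in\Sigma$). In round $t=0,\dots,T-1$ sample $\sigma^t=(\iota,\kappa,\pm)$ from $P_{t,\sigma}\propto\exp(\eta s^t_\sigma)$, play $p^t=\mathrm{equal}^{\pm}(\iota,\kappa,\varepsilon_t)$, observe $v^t$, and set, for all $\sigma\in\Sigma$, $$s^{t+1}_\sigma=s^t_\sigma+1-\frac{L-v^t}{2L}\cdot\frac{\mathbf 1[\sigma=\sigma^t]}{P_{t,\sigma}}.$$ **Theorem.** There is an absolute constant $C$ such that for every game as above, with any $m\ge 2$, and every horizon $T$, this algorithm $\mathcal A$ satisfies $$Reg_T(\mathcal A)\le C\,B\,n\sqrt{T m^2\log m}.$$ In particular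 $Reg_T(\mathcal A)=O(n\sqrt{Tm^2\log m})$ when the per-agent payoff scale $B$ is bounded. -/

import Mathlib

/-- A costly audit game with `m` ordered types `0, …, m - 1`, a continuum of agents of total mass
`n`, and audit cost `cost` (the `λ` of the model) per audit.
`val i k` and `pay k` are the principal's value and payment when a type `i` agent reports `k`;
`pen k` is the penalty that an audited misreporting agent pays for the report `k`. -/
structure AuditGame (m : ℕ) where
  n : ℝ
  val : Fin m → Fin m → ℝ
  pay : Fin m → ℝ
  pen : Fin m → ℝ
  cost : ℝ
  two_le : 2 ≤ m
  n_pos : 0 < n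
  pay_pos : ∀ k, 0 < pay k
  pay_strictMono : StrictMono pay
  val_anti : ∀ i k l, i ≤ k → k ≤ l → val i l ≤ val i k
  pay_le_pen : ∀ k, pay k ≤ pen k
  cost_nonneg : 0 ≤ cost
  cost_le_pen : ∀ k, cost ≤ pen k

/-- Audit vectors: `p k ∈ [0, 1]` is the probability that a report `k` is audited. -/
abbrev AuditVector (m : ℕ) : Type := {p : Fin m → ℝ // ∀ k, p k ∈ Set.Icc (0 : ℝ) 1}

namespace AuditGame

variable {m : ℕ}

/-- Penalty paid by an audited agent of type `i` that reported `k`. -/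
noncomputable def penalty (G : AuditGame m) (i k : Fin m) : ℝ := if i = k then 0 else G.pen k

/-- Expected utility of a type `i` agent that reports `k` under `p`. -/
noncomputable def agentUtility (G : AuditGame m) (p : Fin m → ℝ) (i k : Fin m) : ℝ :=
  G.pay k - p k * G.penalty i k

/-- Bayes-Nash equilibria under `p`: report strategies `Q` (row `i` is the distribution of the
report of a type `i` agent) that put weight on best responses only. -/
def equilibria (G : AuditGame m) (p : Fin m → ℝ) : Set (Fin m → Fin m → ℝ) :=
  {Q | (∀ i, Q i ∈ stdSimplex ℝ (Fin m)) ∧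
    ∀ i k l, 0 < Q i k → G.agentUtility p i l ≤ G.agentUtility p i k}

/-- The principal's utility under audit vector `p`, report strategy `Q` and prior `q`, without
the cost of audits. -/
noncomputable def grossUtility (G : AuditGame m) (p : Fin m → ℝ) (Q : Fin m → Fin m → ℝ)
    (q : Fin m → ℝ) : ℝ :=
  G.n * ∑ i, ∑ k, q i * Q i k * (G.val i k - G.pay k + p k * G.penalty i k)

/-- Expected number (mass) of audits. -/
noncomputable def audits (G : AuditGame m) (p : Fin m → ℝ) (Q : Fin m → Fin m → ℝ)
    (q : Fin m → ℝ) : ℝ :=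
  G.n * ∑ i, ∑ k, q i * Q i k * p k

/-- The principal's utility `V_λ(p, Q; q)`. -/
noncomputable def utility (G : AuditGame m) (p : Fin m → ℝ) (Q : Fin m → Fin m → ℝ)
    (q : Fin m → ℝ) : ℝ :=
  G.grossUtility p Q q - G.cost * G.audits p Q q

/-- The principal's worst-case equilibrium utility `V_λ(p; q) = min_Q V_λ(p, Q; q)`, where `Q`
ranges over the equilibria under `p`. -/
noncomputable def value (G : AuditGame m) (p : Fin m → ℝ) (q : Fin m → ℝ) : ℝ :=
  sInf ((fun Q => G.utility p Q q) '' G.equilibria p)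

/-- The infimum that defines `value` is a minimum. -/
theorem value_isLeast (G : AuditGame m) (p q : Fin m → ℝ) :
    IsLeast ((fun Q => G.utility p Q q) '' G.equilibria p) (G.value p q) := by
  have hm : 0 < m := lt_of_lt_of_le (by norm_num) G.two_le
  have : Nonempty (Fin m) := ⟨⟨0, hm⟩⟩
  have hne : (G.equilibria p).Nonempty := by
    choose f hf using fun i => Finite.exists_max (G.agentUtility p i)
    refine ⟨fun i => Pi.single (f i) 1, fun i => single_mem_stdSimplex ℝ (f i), ?_⟩
    intro i k l hk
    by_cases h : k = f i
    · rw [h]; exact hf i l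
    · simp [h] at hk
  have hcpt : IsCompact (G.equilibria p) := by
    have h1 : IsCompact (Set.pi Set.univ fun _ : Fin m => stdSimplex ℝ (Fin m)) :=
      isCompact_univ_pi fun _ => isCompact_stdSimplex ℝ (Fin m)
    have h2 : IsClosed {Q : Fin m → Fin m → ℝ |
        ∀ i k l, 0 < Q i k → G.agentUtility p i l ≤ G.agentUtility p i k} := by
      simp only [Set.ofPred_forall]
      refine isClosed_iInter fun i => isClosed_iInter fun k => isClosed_iInter fun l => ?_
      by_cases h : G.agentUtility p i l ≤ G.agentUtility p i k
      · simp [h]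
      · have hc : Continuous fun Q : Fin m → Fin m → ℝ => Q i k := by fun_prop
        simpa [h, Set.ofPred_forall] using isClosed_le hc continuous_const
    have h3 : G.equilibria p = (Set.pi Set.univ fun _ : Fin m => stdSimplex ℝ (Fin m)) ∩
        {Q | ∀ i k l, 0 < Q i k → G.agentUtility p i l ≤ G.agentUtility p i k} := by
      ext Q; simp only [equilibria, Set.mem_ofPred_eq, Set.mem_inter_iff, Set.mem_univ_pi]
    rw [h3]; exact h1.inter_right h2
  have hcont : Continuous fun Q => G.utility p Q q := by
    unfold utility grossUtility audits; fun_prop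
  exact (hcpt.image hcont).isLeast_sInf (hne.image _)

/-- `pay (k - 1)`, with the convention `pay (-1) = 0`. -/
noncomputable def payPrev (G : AuditGame m) (k : Fin m) : ℝ :=
  if (k : ℕ) = 0 then 0 else G.pay ⟨(k : ℕ) - 1, by omega⟩

/-- The minimal payment gap `γ = min_k (pay k - pay (k - 1))`. -/
noncomputable def gap (G : AuditGame m) : ℝ := ⨅ k, (G.pay k - G.payPrev k)

/-- `ρ_k(u)`: the audit probability at which misreporting as `k` has utility `u`. -/
noncomputable def rho (G : AuditGame m) (k : Fin m) (u : ℝ) : ℝ := (G.pay k - u) / G.pen k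

/-- The equalized audit vector with misreport utility `u`, misreporting range `{κ}` and slack `ε`.
As `pay` is increasing, `pay k < u` says that `k` is below the least type `ι` with `u ≤ pay ι`. -/
noncomputable def equalized (G : AuditGame m) (u : ℝ) (κ : Fin m) (ε : ℝ) (k : Fin m) : ℝ :=
  if G.pay k < u then 0 else if k = κ then G.rho k u else G.rho k (u - ε)

/-- The critical audit vectors `equal⁺(ι, κ, ε)` (for `true`) and `equal⁻(ι, κ, ε)`
(for `false`). -/
noncomputable def critical (G : AuditGame m) (ι κ : Fin m) (s : Bool) (ε : ℝ) : Fin m → ℝ :=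
  G.equalized (if s then G.payPrev ι + ε else G.pay ι - ε) κ ε

theorem payPrev_nonneg (G : AuditGame m) (k : Fin m) : 0 ≤ G.payPrev k := by
  unfold payPrev; split_ifs
  · exact le_rfl
  · exact (G.pay_pos _).le

theorem gap_le (G : AuditGame m) (k : Fin m) : G.gap ≤ G.pay k - G.payPrev k :=
  ciInf_le (Set.finite_range _).bddBelow k

theorem gap_pos (G : AuditGame m) : 0 < G.gap := by
  have : Nonempty (Fin m) := ⟨⟨0, lt_of_lt_of_le (by norm_num) G.two_le⟩⟩
  obtain ⟨k, hk⟩ := exists_eq_ciInf_of_finite (f := fun k => G.pay k - G.payPrev k)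
  rw [gap, ← hk, sub_pos]
  unfold payPrev; split_ifs with h
  · exact G.pay_pos k
  · exact G.pay_strictMono (Fin.lt_def.2 (by simp only; omega))

theorem critical_mem (G : AuditGame m) (ι κ : Fin m) (s : Bool) {ε : ℝ} (h0 : 0 < ε)
    (h1 : ε < G.gap / 2) (k : Fin m) : G.critical ι κ s ε k ∈ Set.Icc (0 : ℝ) 1 := by
  have hg := G.gap_le ι
  have hp := G.payPrev_nonneg ι
  have key : ∀ u, 0 ≤ u → u ≤ G.pay k → G.rho k u ∈ Set.Icc (0 : ℝ) 1 := fun u hu huk => by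
    have hpen : 0 < G.pen k := (G.pay_pos k).trans_le (G.pay_le_pen k)
    refine ⟨div_nonneg (by linarith) hpen.le, (div_le_one hpen).2 ?_⟩
    linarith [G.pay_le_pen k]
  unfold critical equalized
  cases s <;> simp only [if_true, Bool.false_eq_true, if_false] <;> split_ifs with ha hb
  all_goals first
    | exact ⟨le_rfl, zero_le_one⟩
    | (apply key <;> linarith)

end AuditGame

/-- A randomized online algorithm for the principal, with bandit feedback: given the arms pulled
and the utilities obtained in the rounds `0, …, t - 1`, `dist` is the distribution of the arm of
round `t`; pulling arm `a` in round `t` means playing the audit vector `play t a`. -/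
structure OnlineAlgorithm (m : ℕ) (Arm : Type) [Fintype Arm] where
  dist : (t : ℕ) → (Fin t → Arm × ℝ) → stdSimplex ℝ Arm
  play : ℕ → Arm → AuditVector m

namespace OnlineAlgorithm

variable {m : ℕ} {Arm : Type} [Fintype Arm] {T : ℕ}

/-- The principal's utility in round `t` when arm `a` is pulled and the prior is `q`. -/
noncomputable def reward (A : OnlineAlgorithm m Arm) (G : AuditGame m) (t : ℕ) (a : Arm)
    (q : stdSimplex ℝ (Fin m)) : ℝ :=
  G.value (A.play t a) q

/-- What the principal has seen before round `t`, if the arms pulled are `σ` and the priors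
are `q`. -/
noncomputable def transcript (A : OnlineAlgorithm m Arm) (G : AuditGame m)
    (q : Fin T → stdSimplex ℝ (Fin m)) (σ : Fin T → Arm) (t : Fin T) : Fin t → Arm × ℝ :=
  fun r => (σ (r.castLE t.2.le), A.reward G r (σ (r.castLE t.2.le)) (q (r.castLE t.2.le)))

/-- The probability that the arms pulled in the rounds `0, …, T - 1` are `σ`. -/
noncomputable def runProb (A : OnlineAlgorithm m Arm) (G : AuditGame m)
    (q : Fin T → stdSimplex ℝ (Fin m)) (σ : Fin T → Arm) : ℝ :=
  ∏ t : Fin T, (A.dist t (A.transcript G q σ t) : Arm → ℝ) (σ t)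

/-- The expected total utility of the principal over the rounds `0, …, T - 1`. -/
noncomputable def expectedTotal (A : OnlineAlgorithm m Arm) (G : AuditGame m)
    (q : Fin T → stdSimplex ℝ (Fin m)) : ℝ :=
  ∑ σ : Fin T → Arm, A.runProb G q σ * ∑ t : Fin T, A.reward G t (σ t) (q t)

/-- Stackelberg regret `Reg_T(A, q)` against the best fixed audit vector in hindsight. -/
noncomputable def regretAgainst (A : OnlineAlgorithm m Arm) (G : AuditGame m)
    (q : Fin T → stdSimplex ℝ (Fin m)) : EReal :=
  (⨆ p : AuditVector m, ((∑ t : Fin T, G.value p (q t) : ℝ) : EReal)) -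
    ((A.expectedTotal G q : ℝ) : EReal)

/-- Stackelberg regret `Reg_T(A)`: the worst case over all sequences of priors. -/
noncomputable def regret (A : OnlineAlgorithm m Arm) (G : AuditGame m) (T : ℕ) : EReal :=
  ⨆ q : Fin T → stdSimplex ℝ (Fin m), A.regretAgainst G q

end OnlineAlgorithm

/-- Templates of critical audit vectors: `(ι, κ, true)` stands for `equal⁺(ι, κ, ·)` and
`(ι, κ, false)` for `equal⁻(ι, κ, ·)`. -/
abbrev Template (m : ℕ) : Type := Fin m × Fin m × Bool

/-- Sampling probabilities proportional to `exp (x a)`. -/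
noncomputable def softmax {α : Type} [Fintype α] (x : α → ℝ) (a : α) : ℝ :=
  Real.exp (x a) / ∑ b, Real.exp (x b)

theorem softmax_mem {α : Type} [Fintype α] [Nonempty α] (x : α → ℝ) :
    softmax x ∈ stdSimplex ℝ α := by
  have h : 0 < ∑ b, Real.exp (x b) :=
    Finset.sum_pos (fun b _ => Real.exp_pos _) Finset.univ_nonempty
  refine ⟨fun a => (div_pos (Real.exp_pos _) h).le, ?_⟩
  simp only [softmax, ← Finset.sum_div]
  exact div_self h.ne'

namespace AuditGame

variable {m : ℕ}

/-- The per-agent payoff scale `max_{i,k} (|val i k| + pay k + pen k)`. -/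
noncomputable def payoffScale (G : AuditGame m) : ℝ :=
  ⨆ x : Fin m × Fin m, (|G.val x.1 x.2| + G.pay x.2 + G.pen x.2)

/-- The normalization constant `L` of the algorithm. -/
noncomputable def normConst (G : AuditGame m) : ℝ := G.n * G.payoffScale

/-- The learning rate `η = √(log (2 m²) / (2 m² T))`. -/
noncomputable def learningRate (m T : ℕ) : ℝ :=
  √(Real.log (2 * (m : ℝ) ^ 2) / (2 * (m : ℝ) ^ 2 * T))

/-- `ε_t = 2⁻ᵗ ε_0` with `ε_0 = γ / 3`. -/
noncomputable def slack (G : AuditGame m) (t : ℕ) : ℝ := G.gap / 3 / 2 ^ t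

/-- The score vectors `s^t` of EXP3 with horizon `T`, after the history `h` of sampled templates
and observed utilities. The update of round `t` is
`s^{t+1}_τ = s^t_τ + 1 - (L - v^t) / (2 L) * 𝟙[τ = σ^t] / P_{t,τ}`. -/
noncomputable def exp3Score (G : AuditGame m) (T : ℕ) :
    (t : ℕ) → (Fin t → Template m × ℝ) → Template m → ℝ
  | 0, _, _ => 0
  | t + 1, h, τ =>
    let s : Template m → ℝ := exp3Score G T t (fun r => h r.castSucc)
    let σ : Template m := (h (Fin.last t)).1
    let v : ℝ := (h (Fin.last t)).2
    s τ + 1 - (G.normConst - v) / (2 * G.normConst) *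
      ((if τ = σ then 1 else 0) / softmax (fun b => learningRate m T * s b) τ)

theorem slack_pos (G : AuditGame m) (t : ℕ) : 0 < G.slack t :=
  div_pos (div_pos G.gap_pos (by norm_num)) (by positivity)

theorem slack_lt (G : AuditGame m) (t : ℕ) : G.slack t < G.gap / 2 := by
  have h := G.gap_pos
  have h1 : G.slack t ≤ G.gap / 3 :=
    div_le_self (by linarith) (one_le_pow₀ (by norm_num))
  linarith

theorem template_nonempty (G : AuditGame m) : Nonempty (Template m) :=
  ⟨(⟨0, lt_of_lt_of_le (by norm_num) G.two_le⟩, ⟨0, lt_of_lt_of_le (by norm_num) G.two_le⟩, true)⟩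

/-- EXP3 over the templates of critical audit vectors, with horizon `T`. -/
noncomputable def exp3 (G : AuditGame m) (T : ℕ) : OnlineAlgorithm m (Template m) where
  dist t h :=
    ⟨softmax fun τ => learningRate m T * G.exp3Score T t h τ,
      haveI := G.template_nonempty; softmax_mem _⟩
  play t σ :=
    ⟨G.critical σ.1 σ.2.1 σ.2.2 (G.slack t),
      G.critical_mem σ.1 σ.2.1 σ.2.2 (G.slack_pos t) (G.slack_lt t)⟩

end AuditGame

/-! The proof reduces the continuum of audit vectors to `2 m²` critical ones and then runs EXP3 on
these. Reduction: under any `p`, only the best misreport `κ` and its utility `u` matter. With `ι`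
the least type satisfying `u ≤ pay ι`, types below `ι` may report `κ`, the others may be truthful,
and this response caps the value by an ideal payoff that is affine in `u` on `[payPrev ι, pay ι]`
with slope in `[-1, 1]` (`exists_value_le_ideal`, `idealPayoff_affine`). Conversely, a vector
equalized with slack `ε` forces this response as the only equilibrium, at a loss of at most `ε` per
agent (`le_value_equalized`). Hence `p` is dominated, up to `2 n ε`, by a mixture of the two
endpoint vectors (`exists_value_le_critical`). The mixture does not depend on the prior, so over all
rounds one of the two fixed templates does as well as `p`, up to a geometric sum of slacks.
Learning: the potential `log ∑ exp (η s) - η s c` starts at `log K`, stays nonnegative, and in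
expectation pays for `η` times the regret while gaining at most `η² K / 2` per round (`exp3_step`),
where `K = 2 m²`. The prescribed `η` balances the two terms. -/

/-! ### Path probabilities of a randomized policy -/

/-- The probability of the path `σ` under a policy `π` that depends on the past path. -/
noncomputable def pathProb {Arm : Type} (π : (t : ℕ) → (Fin t → Arm) → Arm → ℝ) (t : ℕ)
    (σ : Fin t → Arm) : ℝ :=
  ∏ r : Fin t, π r (fun j => σ (j.castLE r.2.le)) (σ r)

theorem pathProb_snoc {Arm : Type} (π : (t : ℕ) → (Fin t → Arm) → Arm → ℝ) (t : ℕ)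
    (σ : Fin t → Arm) (a : Arm) :
    pathProb π (t + 1) (Fin.snoc (α := fun _ => Arm) σ a) = pathProb π t σ * π t σ a := by
  unfold pathProb
  rw [Fin.prod_univ_castSucc]
  congr 1
  · refine Finset.prod_congr rfl fun r _ => ?_
    rw [Fin.snoc_castSucc]
    congr 1
    funext j
    exact Fin.snoc_castSucc (α := fun _ => Arm) a σ (j.castLE r.2.le)
  · rw [Fin.snoc_last]
    congr 1
    funext j
    exact Fin.snoc_castSucc (α := fun _ => Arm) a σ j

theorem sum_fin_succ_fun {Arm : Type} [Fintype Arm] (t : ℕ) (f : (Fin (t + 1) → Arm) → ℝ) :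
    ∑ σ, f σ = ∑ σ : Fin t → Arm, ∑ a, f (Fin.snoc (α := fun _ => Arm) σ a) := by
  rw [← (Fin.snocEquiv fun _ => Arm).sum_comp, Fintype.sum_prod_type, Finset.sum_comm]
  rfl

theorem pathProb_nonneg {Arm : Type} {π : (t : ℕ) → (Fin t → Arm) → Arm → ℝ}
    (hπ : ∀ t σ a, 0 ≤ π t σ a) (t : ℕ) (σ : Fin t → Arm) : 0 ≤ pathProb π t σ :=
  Finset.prod_nonneg fun _ _ => hπ _ _ _

theorem sum_pathProb {Arm : Type} [Fintype Arm] {π : (t : ℕ) → (Fin t → Arm) → Arm → ℝ}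
    (hπ : ∀ t σ, ∑ a, π t σ a = 1) (t : ℕ) : ∑ σ, pathProb π t σ = 1 := by
  induction t with
  | zero => simp [pathProb]
  | succ t ih =>
    rw [sum_fin_succ_fun]
    simp_rw [pathProb_snoc, ← Finset.mul_sum, hπ, mul_one, ih]

/-! ### Exponential weights with bandit feedback -/

/-- Follows from `exp x ≥ 1 + x + x²/2` and `(1 + x + x²/2)(1 - x + x²/2) = 1 + x⁴/4 ≥ 1`. No upper
bound on `x` is needed, so the estimates `l / P a` may be arbitrarily large and no forced
exploration is required. -/
theorem exp_neg_le_quadratic {x : ℝ} (hx : 0 ≤ x) : Real.exp (-x) ≤ 1 - x + x ^ 2 / 2 := by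
  have h := Real.quadratic_le_exp_of_nonneg hx
  rw [Real.exp_neg]
  refine inv_le_of_inv_le₀ (by nlinarith [sq_nonneg (x - 1)]) (le_trans ?_ h)
  rw [inv_le_iff_one_le_mul₀ (by nlinarith [sq_nonneg (x - 1)])]
  nlinarith [sq_nonneg (x ^ 2)]

section Exponential

variable {Arm : Type} [Fintype Arm]

theorem softmax_pos [Nonempty Arm] (x : Arm → ℝ) (a : Arm) : 0 < softmax x a :=
  div_pos (Real.exp_pos _) (Finset.sum_pos (fun _ _ => Real.exp_pos _) Finset.univ_nonempty)

/-- The potential of the exponential weights analysis, relative to the arm `c`. -/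
noncomputable def expPotential (η : ℝ) (s : Arm → ℝ) (c : Arm) : ℝ :=
  Real.log (∑ b, Real.exp (η * s b)) - η * s c

theorem expPotential_nonneg (η : ℝ) (s : Arm → ℝ) (c : Arm) : 0 ≤ expPotential η s c := by
  rw [expPotential, sub_nonneg]
  conv_lhs => rw [← Real.log_exp (η * s c)]
  exact Real.log_le_log (Real.exp_pos _)
    (Finset.single_le_sum (f := fun b => Real.exp (η * s b)) (fun b _ => (Real.exp_pos _).le)
      (Finset.mem_univ c))

/-- The EXP3 score update after arm `a` with loss `l` was sampled. -/
noncomputable def exp3Update [DecidableEq Arm] (η : ℝ) (s : Arm → ℝ) (l : ℝ) (a b : Arm) : ℝ :=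
  s b + 1 - l * ((if b = a then 1 else 0) / softmax (fun d => η * s d) b)

/-- Apart from the common factor `exp η`, only the weight of the sampled arm changes, so the sum
becomes `exp η * Z * (1 + y)`; then `log (1 + y) ≤ y` and the quadratic bound on `exp` apply. -/
theorem log_sum_exp_update_le [DecidableEq Arm] {η l : ℝ} (hη : 0 ≤ η) (hl : 0 ≤ l)
    (s : Arm → ℝ) (a : Arm) :
    Real.log (∑ b, Real.exp (η * exp3Update η s l a b)) ≤
      Real.log (∑ b, Real.exp (η * s b)) + η - η * l +
        η ^ 2 * l ^ 2 / (2 * softmax (fun d => η * s d) a) := by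
  have : Nonempty Arm := ⟨a⟩
  set P := softmax (fun d => η * s d) with hP
  set Z := ∑ b, Real.exp (η * s b) with hZ
  have hZpos : 0 < Z := Finset.sum_pos (fun b _ => Real.exp_pos _) Finset.univ_nonempty
  have hPa : 0 < P a := softmax_pos _ a
  have hsum : ∑ b, P b = 1 := (softmax_mem fun d => η * s d).2
  have hterm : ∀ b, Real.exp (η * exp3Update η s l a b) =
      Real.exp η * Z * (P b + if b = a then P a * (Real.exp (-(η * l / P a)) - 1) else 0) := by
    intro b
    have hb : Real.exp (η * s b) = Z * P b := by
      rw [hP, softmax, ← hZ]; field_simp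
    unfold exp3Update
    rw [← hP]
    split_ifs with h
    · subst h
      have : η * (s b + 1 - l * (1 / P b)) = η + η * s b + -(η * l / P b) := by ring
      rw [this, Real.exp_add, Real.exp_add, hb]; ring
    · have : η * (s b + 1 - l * (0 / P b)) = η + η * s b := by ring
      rw [this, Real.exp_add, hb]; ring
  set y := P a * (Real.exp (-(η * l / P a)) - 1) with hy
  have hcalc : ∑ b, Real.exp (η * exp3Update η s l a b) = Real.exp η * Z * (1 + y) := by
    simp_rw [hterm, ← Finset.mul_sum, Finset.sum_add_distrib, hsum]
    simp
  have hy1 : 0 < 1 + y := by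
    have h0 : 0 < ∑ b, Real.exp (η * exp3Update η s l a b) :=
      Finset.sum_pos (fun b _ => Real.exp_pos _) Finset.univ_nonempty
    rw [hcalc] at h0
    exact (mul_pos_iff_of_pos_left (mul_pos (Real.exp_pos _) hZpos)).1 h0
  rw [hcalc, Real.log_mul (by positivity) hy1.ne', Real.log_mul (by positivity) hZpos.ne',
    Real.log_exp]
  have h1 := Real.log_le_sub_one_of_pos hy1
  have h2 : y ≤ -(η * l) + η ^ 2 * l ^ 2 / (2 * P a) := by
    have h3 := exp_neg_le_quadratic (x := η * l / P a) (by positivity)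
    have h4 : y ≤ P a * (-(η * l / P a) + (η * l / P a) ^ 2 / 2) :=
      mul_le_mul_of_nonneg_left (by linarith) hPa.le
    refine h4.trans_eq ?_
    field_simp
  linarith

/-- One round of EXP3: the expected change of the potential pays for the instantaneous regret. -/
theorem exp3_step [DecidableEq Arm] {η : ℝ} (hη : 0 ≤ η) {l : Arm → ℝ}
    (h0 : ∀ a, 0 ≤ l a) (h1 : ∀ a, l a ≤ 1) (s : Arm → ℝ) (c : Arm) :
    ∑ a, softmax (fun d => η * s d) a *
        (η * (l a - l c) + expPotential η (exp3Update η s (l a) a) c) ≤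
      expPotential η s c + η ^ 2 * Fintype.card Arm / 2 := by
  have : Nonempty Arm := ⟨c⟩
  set P := softmax (fun d => η * s d) with hP
  have hpos : ∀ a, 0 < P a := softmax_pos _
  have hsum : ∑ b, P b = 1 := (softmax_mem fun d => η * s d).2
  -- The term `η l a` cancels against the drop of the log-sum, and the shift `η` against that of the
  -- comparator's score. The factor `P a` cancels both importance weights, so each arm contributes
  -- at most `η²/2` of variance.
  have hbound : ∀ a, P a * (η * (l a - l c) + expPotential η (exp3Update η s (l a) a) c) ≤
      P a * (expPotential η s c - η * l c) + (if c = a then η * l c else 0) + η ^ 2 / 2 := by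
    intro a
    have h := log_sum_exp_update_le hη (h0 a) s a
    rw [← hP] at h
    have hup : η * exp3Update η s (l a) a c =
        η * s c + η - (if c = a then η * l c else 0) / P a := by
      unfold exp3Update
      rw [← hP]
      split_ifs with hca
      · subst hca; ring
      · ring
    have hsq : l a ^ 2 ≤ 1 := pow_le_one₀ (h0 a) (h1 a)
    have hPa := hpos a
    have hq : η ^ 2 * l a ^ 2 / (2 * P a) ≤ η ^ 2 / 2 / P a := by
      rw [div_div]
      gcongr
      nlinarith [sq_nonneg η]
    calc _ ≤ P a * (expPotential η s c - η * l c + (if c = a then η * l c else 0) / P a +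
            η ^ 2 / 2 / P a) := by
          refine mul_le_mul_of_nonneg_left ?_ (hpos a).le
          unfold expPotential
          rw [hup]
          linarith
      _ = _ := by
          have := (hpos a).ne'
          field_simp
  refine (Finset.sum_le_sum fun a _ => hbound a).trans_eq ?_
  rw [Finset.sum_add_distrib, Finset.sum_add_distrib, ← Finset.sum_mul, hsum]
  simp
  ring

/-- The regret bound of EXP3 against an oblivious adversary with losses in `[0, 1]`. -/
theorem exp3_potential_bound [DecidableEq Arm] {η : ℝ} (hη : 0 ≤ η) {l : ℕ → Arm → ℝ}
    (h0 : ∀ t a, 0 ≤ l t a) (h1 : ∀ t a, l t a ≤ 1)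
    (S : (t : ℕ) → (Fin t → Arm) → Arm → ℝ) (hS0 : ∀ σ a, S 0 σ a = 0)
    (hS : ∀ t σ a, S (t + 1) (Fin.snoc (α := fun _ => Arm) σ a) =
      exp3Update η (S t σ) (l t a) a) (c : Arm) (t : ℕ) :
    ∑ σ, pathProb (fun r σ => softmax fun d => η * S r σ d) t σ *
        (η * ∑ r : Fin t, (l r (σ r) - l r c) + expPotential η (S t σ) c) ≤
      Real.log (Fintype.card Arm) + t * (η ^ 2 * Fintype.card Arm / 2) := by
  have : Nonempty Arm := ⟨c⟩
  induction t with
  | zero => simp [pathProb, expPotential, hS0]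
  | succ t ih =>
    rw [sum_fin_succ_fun]
    have key : ∀ σ : Fin t → Arm,
        ∑ a, pathProb (fun r σ => softmax fun d => η * S r σ d) (t + 1)
            (Fin.snoc (α := fun _ => Arm) σ a) *
          (η * ∑ r : Fin (t + 1), (l r (Fin.snoc (α := fun _ => Arm) σ a r) - l r c) +
            expPotential η (S (t + 1) (Fin.snoc (α := fun _ => Arm) σ a)) c) ≤
        pathProb (fun r σ => softmax fun d => η * S r σ d) t σ *
          (η * ∑ r : Fin t, (l r (σ r) - l r c) + expPotential η (S t σ) c) +
        pathProb (fun r σ => softmax fun d => η * S r σ d) t σ *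
          (η ^ 2 * Fintype.card Arm / 2) := by
      intro σ
      have hp : 0 ≤ pathProb (fun r σ => softmax fun d => η * S r σ d) t σ :=
        pathProb_nonneg (fun _ _ a => (softmax_pos _ a).le) t σ
      have hst := exp3_step hη (h0 t) (h1 t) (S t σ) c
      have hsum : ∑ a, softmax (fun d => η * S t σ d) a = 1 := (softmax_mem _).2
      rw [← mul_add]
      simp_rw [pathProb_snoc, mul_assoc, ← Finset.mul_sum]
      refine mul_le_mul_of_nonneg_left ?_ hp
      calc _ = ∑ a, (softmax (fun d => η * S t σ d) a * (η * ∑ r : Fin t, (l r (σ r) - l r c)) +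
            softmax (fun d => η * S t σ d) a *
              (η * (l t a - l t c) + expPotential η (exp3Update η (S t σ) (l t a) a) c)) := by
            refine Finset.sum_congr rfl fun a _ => ?_
            rw [Fin.sum_univ_castSucc, hS]
            simp only [Fin.snoc_castSucc, Fin.snoc_last, Fin.val_castSucc, Fin.val_last]
            ring
        _ ≤ _ := by
            rw [Finset.sum_add_distrib, ← Finset.sum_mul, hsum, one_mul]
            linarith
    refine (Finset.sum_le_sum fun σ _ => key σ).trans ?_
    rw [Finset.sum_add_distrib, ← Finset.sum_mul,
      sum_pathProb (fun _ _ => (softmax_mem _).2)]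
    push_cast
    linarith

/-- The final potential is nonnegative and can be dropped; the comparator's loss is the same on all
paths, so it leaves the expectation. -/
theorem exp3_regret_le [DecidableEq Arm] {η : ℝ} (hη : 0 ≤ η) {l : ℕ → Arm → ℝ}
    (h0 : ∀ t a, 0 ≤ l t a) (h1 : ∀ t a, l t a ≤ 1)
    (S : (t : ℕ) → (Fin t → Arm) → Arm → ℝ) (hS0 : ∀ σ a, S 0 σ a = 0)
    (hS : ∀ t σ a, S (t + 1) (Fin.snoc (α := fun _ => Arm) σ a) =
      exp3Update η (S t σ) (l t a) a) (c : Arm) (t : ℕ) :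
    η * (∑ σ, pathProb (fun r σ => softmax fun d => η * S r σ d) t σ *
        ∑ r : Fin t, l r (σ r) - ∑ r : Fin t, l r c) ≤
      Real.log (Fintype.card Arm) + t * (η ^ 2 * Fintype.card Arm / 2) := by
  have : Nonempty Arm := ⟨c⟩
  refine le_trans ?_ (exp3_potential_bound hη h0 h1 S hS0 hS c t)
  have hsum := sum_pathProb (π := fun r σ => softmax fun d => η * S r σ d)
    (fun _ _ => (softmax_mem _).2) t
  calc _ = ∑ σ, pathProb (fun r σ => softmax fun d => η * S r σ d) t σ *
        (η * ∑ r : Fin t, (l r (σ r) - l r c)) := by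
        simp_rw [Finset.sum_sub_distrib, mul_sub, Finset.sum_sub_distrib, ← Finset.sum_mul, hsum,
          one_mul, mul_left_comm _ η, ← Finset.mul_sum]
    _ ≤ _ := by
        refine Finset.sum_le_sum fun σ _ => mul_le_mul_of_nonneg_left ?_
          (pathProb_nonneg (fun _ _ a => (softmax_pos _ a).le) t σ)
        linarith [expPotential_nonneg η (S t σ) c]

end Exponential

/-! ### Bounds on payoffs and on the equilibrium value -/

namespace AuditGame

variable {m : ℕ}

theorem pen_pos (G : AuditGame m) (k : Fin m) : 0 < G.pen k :=
  (G.pay_pos k).trans_le (G.pay_le_pen k)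

/-- The principal's payoff from a type `i` agent that reports `k` under `p`. -/
noncomputable def payoff (G : AuditGame m) (p : Fin m → ℝ) (i k : Fin m) : ℝ :=
  G.val i k - G.pay k + p k * G.penalty i k - G.cost * p k

theorem utility_eq (G : AuditGame m) (p : Fin m → ℝ) (Q : Fin m → Fin m → ℝ) (q : Fin m → ℝ) :
    G.utility p Q q = G.n * ∑ i, q i * ∑ k, Q i k * G.payoff p i k := by
  unfold utility grossUtility audits payoff
  rw [mul_left_comm, ← mul_sub]
  congr 1
  simp_rw [Finset.mul_sum, ← Finset.sum_sub_distrib]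
  refine Finset.sum_congr rfl fun i _ => Finset.sum_congr rfl fun k _ => ?_
  ring

/-- The value is at most the principal's utility from any selection of best responses. -/
theorem value_le (G : AuditGame m) (p q : Fin m → ℝ) (f : Fin m → Fin m)
    (hf : ∀ i l, G.agentUtility p i l ≤ G.agentUtility p i (f i)) :
    G.value p q ≤ G.n * ∑ i, q i * G.payoff p i (f i) := by
  refine (G.value_isLeast p q).2 ⟨fun i => Pi.single (f i) 1,
    ⟨fun i => single_mem_stdSimplex ℝ (f i), ?_⟩, ?_⟩
  · intro i k l hk
    by_cases h : k = f i
    · rw [h]; exact hf i l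
    · simp [h] at hk
  · simp only [utility_eq]
    congr 1
    refine Finset.sum_congr rfl fun i _ => ?_
    simp [Pi.single_apply]

/-- Each row of an equilibrium averages over best responses, so a bound for every best response
survives the averaging. -/
theorem le_value (G : AuditGame m) (p : Fin m → ℝ) {q : Fin m → ℝ} (hq : ∀ i, 0 ≤ q i)
    (c : Fin m → ℝ) (hc : ∀ i k, (∀ l, G.agentUtility p i l ≤ G.agentUtility p i k) →
      c i ≤ G.payoff p i k) :
    G.n * ∑ i, q i * c i ≤ G.value p q := by
  obtain ⟨Q, ⟨hQ, hbest⟩, hval⟩ := (G.value_isLeast p q).1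
  rw [← hval]
  simp only [utility_eq]
  refine mul_le_mul_of_nonneg_left (Finset.sum_le_sum fun i _ =>
    mul_le_mul_of_nonneg_left ?_ (hq i)) G.n_pos.le
  calc c i = ∑ k, Q i k * c i := by rw [← Finset.sum_mul, (hQ i).2, one_mul]
    _ ≤ _ := Finset.sum_le_sum fun k _ => by
      rcases ((hQ i).1 k).eq_or_lt with h | h
      · simp [← h]
      · exact mul_le_mul_of_nonneg_left (hc i k fun l => hbest i k l h) h.le

theorem le_payoffScale (G : AuditGame m) (i k : Fin m) :
    |G.val i k| + G.pay k + G.pen k ≤ G.payoffScale :=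
  le_ciSup (f := fun x : Fin m × Fin m => |G.val x.1 x.2| + G.pay x.2 + G.pen x.2)
    (Set.finite_range _).bddAbove (i, k)

theorem abs_payoff_le (G : AuditGame m) {p : Fin m → ℝ} (hp : ∀ k, p k ∈ Set.Icc (0 : ℝ) 1)
    (i k : Fin m) : |G.payoff p i k| ≤ G.payoffScale := by
  refine le_trans ?_ (G.le_payoffScale i k)
  have h1 := neg_abs_le (G.val i k)
  have h2 := le_abs_self (G.val i k)
  have hpay := G.pay_pos k
  have hpen := G.pen_pos k
  obtain ⟨hp0, hp1⟩ := hp k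
  have hc0 := mul_nonneg G.cost_nonneg hp0
  have hcp : G.cost * p k ≤ p k * G.pen k := by
    rw [mul_comm]; exact mul_le_mul_of_nonneg_left (G.cost_le_pen k) hp0
  have hpp : p k * G.pen k ≤ G.pen k := mul_le_of_le_one_left hpen.le hp1
  unfold payoff penalty
  rw [abs_le]
  split_ifs <;> constructor <;> linarith

/-- This is what puts the normalized losses `(L - v) / (2 L)` in `[0, 1]`. -/
theorem abs_value_le (G : AuditGame m) {p : Fin m → ℝ} (hp : ∀ k, p k ∈ Set.Icc (0 : ℝ) 1)
    {q : Fin m → ℝ} (hq : q ∈ stdSimplex ℝ (Fin m)) : |G.value p q| ≤ G.normConst := by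
  have hm : 0 < m := lt_of_lt_of_le (by norm_num) G.two_le
  have : Nonempty (Fin m) := ⟨⟨0, hm⟩⟩
  rw [abs_le, normConst]
  constructor
  · refine le_trans (le_of_eq ?_) (G.le_value p hq.1 (fun _ => -G.payoffScale)
      fun i k _ => (abs_le.1 (G.abs_payoff_le hp i k)).1)
    rw [← Finset.sum_mul, hq.2]; ring
  · choose f hf using fun i => Finite.exists_max (G.agentUtility p i)
    refine (G.value_le p q f hf).trans (mul_le_mul_of_nonneg_left ?_ G.n_pos.le)
    calc _ ≤ ∑ i, q i * G.payoffScale := Finset.sum_le_sum fun i _ =>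
          mul_le_mul_of_nonneg_left (abs_le.1 (G.abs_payoff_le hp i (f i))).2 (hq.1 i)
      _ = _ := by rw [← Finset.sum_mul, hq.2, one_mul]

theorem gap_le_payoffScale (G : AuditGame m) : G.gap ≤ G.payoffScale := by
  let z : Fin m := ⟨0, lt_of_lt_of_le (by norm_num) G.two_le⟩
  have h1 := G.gap_le z
  have h2 := G.le_payoffScale z z
  linarith [G.payPrev_nonneg z, abs_nonneg (G.val z z), G.pen_pos z]

theorem normConst_pos (G : AuditGame m) : 0 < G.normConst :=
  mul_pos G.n_pos (G.gap_pos.trans_le G.gap_le_payoffScale)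

/-! ### Reduction to critical audit vectors -/

/-- The principal's payoff from type `i` when types below `ι` report `κ`, the others are truthful,
and all misreports `k ≥ ι` have utility `u`. -/
noncomputable def idealPayoff (G : AuditGame m) (ι κ : Fin m) (u : ℝ) (i : Fin m) : ℝ :=
  if i < ι then G.val i κ - u - G.cost * G.rho κ u else G.val i i - G.pay i - G.cost * G.rho i u

/-- The slope is `cost / pen κ - 1` below `ι` and `cost / pen i` otherwise, and `0 ≤ cost ≤ pen`. -/
theorem idealPayoff_affine (G : AuditGame m) (ι κ i : Fin m) :
    ∃ a b : ℝ, |b| ≤ 1 ∧ ∀ u, G.idealPayoff ι κ u i = a + b * u := by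
  have hr : ∀ k, 0 ≤ G.cost / G.pen k ∧ G.cost / G.pen k ≤ 1 := fun k =>
    ⟨div_nonneg G.cost_nonneg (G.pen_pos k).le, (div_le_one (G.pen_pos k)).2 (G.cost_le_pen k)⟩
  unfold idealPayoff rho
  split_ifs with h
  · refine ⟨G.val i κ - G.cost * (G.pay κ / G.pen κ), -1 + G.cost / G.pen κ, ?_, fun u => by ring⟩
    rw [abs_le]; constructor <;> linarith [hr κ]
  · refine ⟨G.val i i - G.pay i - G.cost * (G.pay i / G.pen i), G.cost / G.pen i, ?_,
      fun u => by ring⟩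
    rw [abs_le]; constructor <;> linarith [hr i]

theorem pay_le_payPrev (G : AuditGame m) {i ι : Fin m} (h : i < ι) : G.pay i ≤ G.payPrev ι := by
  have h' := Fin.lt_def.1 h
  unfold payPrev
  rw [if_neg (by omega)]
  exact G.pay_strictMono.monotone (Fin.le_def.2 (by simp only; omega))

theorem agentUtility_self (G : AuditGame m) (p : Fin m → ℝ) (i : Fin m) :
    G.agentUtility p i i = G.pay i := by simp [agentUtility, penalty]

theorem agentUtility_of_ne (G : AuditGame m) (p : Fin m → ℝ) {i k : Fin m} (h : i ≠ k) :
    G.agentUtility p i k = G.pay k - p k * G.pen k := by simp [agentUtility, penalty, h]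

theorem rho_mul_pen (G : AuditGame m) (k : Fin m) (u : ℝ) :
    G.rho k u * G.pen k = G.pay k - u := div_mul_cancel₀ _ (G.pen_pos k).ne'

/-- The slack breaks ties in favour of `κ` among misreports, and `u` lies strictly between
consecutive payments, so best responses are unique and the worst-case equilibrium is the ideal one.
The price is auditing truthful reports `i ≠ κ` more often, which costs `cost / pen i * ε ≤ ε`. -/
theorem le_value_equalized (G : AuditGame m) {ι κ : Fin m} (hκ : ι ≤ κ) {u ε : ℝ} (hε : 0 < ε)
    (h1 : G.payPrev ι < u) (h2 : u < G.pay ι) {q : Fin m → ℝ} (hq : ∀ i, 0 ≤ q i) :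
    G.n * ∑ i, q i * (G.idealPayoff ι κ u i - ε) ≤ G.value (G.equalized u κ ε) q := by
  have hlt : ∀ i, i < ι → G.pay i < u := fun i hi => (G.pay_le_payPrev hi).trans_lt h1
  have hge : ∀ i, ι ≤ i → u < G.pay i := fun i hi =>
    h2.trans_le (G.pay_strictMono.monotone hi)
  have hpκ : G.equalized u κ ε κ = G.rho κ u := by
    simp [equalized, (hge κ hκ).le]
  have hmis : ∀ i k, i ≠ k → k ≠ κ → G.agentUtility (G.equalized u κ ε) i k < u := by
    intro i k hik hk
    rw [G.agentUtility_of_ne _ hik]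
    by_cases hku : G.pay k < u
    · simp [equalized, hku]
    · simp only [equalized, hku, hk, if_false, rho_mul_pen]
      linarith
  refine G.le_value _ hq _ fun i k hbest => ?_
  by_cases hi : i < ι
  · have hiκ : i ≠ κ := (hi.trans_le hκ).ne
    have hκu := hbest κ
    rw [G.agentUtility_of_ne _ hiκ, hpκ, rho_mul_pen] at hκu
    have hk : k = κ := by
      by_contra hk
      by_cases hik : i = k
      · rw [← hik, agentUtility_self] at hκu
        linarith [hlt i hi]
      · linarith [hmis i k hik hk]
    subst hk
    simp only [idealPayoff, hi, if_true, payoff, hpκ, penalty, hiκ, if_false, rho_mul_pen]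
    linarith
  · have hiu := hge i (not_lt.1 hi)
    have hself := hbest i
    rw [agentUtility_self] at hself
    have hk : i = k := by
      by_contra hik
      by_cases hk : k = κ
      · subst hk
        rw [G.agentUtility_of_ne _ hik, hpκ, rho_mul_pen] at hself
        linarith
      · linarith [hmis i k hik hk]
    subst hk
    have hp : G.cost * G.equalized u κ ε i ≤ G.cost * G.rho i u + ε := by
      have hr : G.cost * G.rho i (u - ε) ≤ G.cost * G.rho i u + ε := by
        have : G.cost * G.rho i (u - ε) = G.cost * G.rho i u + G.cost / G.pen i * ε := by
          unfold rho; ring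
        rw [this]
        have := (div_le_one (G.pen_pos i)).2 (G.cost_le_pen i)
        nlinarith
      by_cases hiκ : i = κ
      · rw [hiκ, hpκ]; linarith
      · simpa [equalized, not_lt.2 hiu.le, hiκ] using hr
    simp only [idealPayoff, hi, if_false, payoff, penalty, if_true]
    linarith

/-- The value is a minimum over equilibria, so exhibiting one best-response selection suffices: `κ`
below `ι`, the truth elsewhere. No misreport beats `u`, which forces `p i ≥ ρ_i(u)` and hence the
audit cost on truthful types. -/
theorem exists_value_le_ideal (G : AuditGame m) {p : Fin m → ℝ}
    (hp : ∀ k, p k ∈ Set.Icc (0 : ℝ) 1) :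
    ∃ ι κ : Fin m, ι ≤ κ ∧ ∃ u, G.payPrev ι ≤ u ∧ u ≤ G.pay ι ∧
      ∀ q : Fin m → ℝ, (∀ i, 0 ≤ q i) →
        G.value p q ≤ G.n * ∑ i, q i * G.idealPayoff ι κ u i := by
  have hm : 0 < m := lt_of_lt_of_le (by norm_num) G.two_le
  have : Nonempty (Fin m) := ⟨⟨0, hm⟩⟩
  obtain ⟨κ, hκ⟩ := Finite.exists_max fun k => G.pay k - p k * G.pen k
  set w := G.pay κ - p κ * G.pen κ with hw
  have hwκ : w ≤ G.pay κ := by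
    have := mul_nonneg (hp κ).1 (G.pen_pos κ).le
    linarith
  -- If `w < 0`, nobody gains by misreporting; clipping at `0 = pay (-1)` keeps `u` in the range of
  -- the template `ι = 0`, where no type misreports.
  set u := max w 0 with hu
  have huκ : u ≤ G.pay κ := max_le hwκ (G.pay_pos κ).le
  have hne : (Finset.univ.filter fun i => u ≤ G.pay i).Nonempty := ⟨κ, by simpa using huκ⟩
  set ι := (Finset.univ.filter fun i => u ≤ G.pay i).min' hne with hι
  have hι1 : u ≤ G.pay ι := by simpa using Finset.min'_mem _ hne
  have hι2 : ∀ i, u ≤ G.pay i → ι ≤ i := fun i hi => Finset.min'_le _ _ (by simpa using hi)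
  have hlt : ∀ i, i < ι → G.pay i < u := fun i hi => by
    by_contra h
    exact absurd (hι2 i (not_lt.1 h)) (not_le.2 hi)
  have hge : ∀ i, ¬ i < ι → u ≤ G.pay i := fun i hi =>
    hι1.trans (G.pay_strictMono.monotone (not_lt.1 hi))
  refine ⟨ι, κ, hι2 κ huκ, u, ?_, hι1, fun q hq => ?_⟩
  · unfold payPrev
    split_ifs with h
    · exact le_max_right _ _
    · exact (hlt _ (Fin.lt_def.2 (by simp only; omega))).le
  -- The clipping is inactive as soon as some type lies below `ι`, since then `u > pay i > 0`.
  have hwi : ∀ i, i < ι → w = u := fun i hi => by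
    have h := (G.pay_pos i).trans (hlt i hi)
    rw [hu, max_def] at h ⊢
    split_ifs at h ⊢ with h'
    · exact absurd h (lt_irrefl _)
    · rfl
  have hwu : w ≤ u := le_max_left _ _
  refine (G.value_le p q (fun i => if i < ι then κ else i) fun i l => ?_).trans ?_
  · have hl : i ≠ l → G.agentUtility p i l ≤ w := fun h => by
      rw [G.agentUtility_of_ne _ h]; exact hκ l
    split_ifs with hi
    · have hiκ : i ≠ κ := (hi.trans_le (hι2 κ huκ)).ne
      rw [G.agentUtility_of_ne _ hiκ, ← hw]
      by_cases h : i = l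
      · rw [← h, agentUtility_self, hwi i hi]; exact (hlt i hi).le
      · exact hl h
    · rw [agentUtility_self]
      by_cases h : i = l
      · rw [← h, agentUtility_self]
      · exact (hl h).trans (hwu.trans (hge i hi))
  · refine mul_le_mul_of_nonneg_left (Finset.sum_le_sum fun i _ =>
      mul_le_mul_of_nonneg_left ?_ (hq i)) G.n_pos.le
    split_ifs with hi
    · have hiκ : i ≠ κ := (hi.trans_le (hι2 κ huκ)).ne
      have hpκ : p κ = G.rho κ u := by
        rw [rho, eq_div_iff (G.pen_pos κ).ne', ← hwi i hi, hw]; ring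
      simp only [idealPayoff, hi, if_true, payoff, penalty, hiκ, if_false]
      rw [hpκ, rho_mul_pen]
      linarith
    · have hpi : G.rho i u ≤ p i := by
        rw [rho, div_le_iff₀ (G.pen_pos i)]
        have := hκ i
        linarith
      simp only [idealPayoff, hi, payoff, penalty, if_true, if_false]
      have := mul_le_mul_of_nonneg_left hpi G.cost_nonneg
      linarith

/-- Every audit vector is, for all priors at once, almost dominated by a mixture of two critical
audit vectors. -/
theorem exists_value_le_critical (G : AuditGame m) {p : Fin m → ℝ}
    (hp : ∀ k, p k ∈ Set.Icc (0 : ℝ) 1) :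
    ∃ ι κ : Fin m, ∃ θ ∈ Set.Icc (0 : ℝ) 1, ∀ q ∈ stdSimplex ℝ (Fin m), ∀ ε, 0 < ε →
      ε < G.gap / 2 →
      G.value p q ≤ (1 - θ) * G.value (G.critical ι κ true ε) q +
        θ * G.value (G.critical ι κ false ε) q + 2 * G.n * ε := by
  obtain ⟨ι, κ, hικ, u, hu1, hu2, hval⟩ := G.exists_value_le_ideal hp
  have hgap := G.gap_le ι
  have hD : 0 < G.pay ι - G.payPrev ι := G.gap_pos.trans_le hgap
  set θ := (u - G.payPrev ι) / (G.pay ι - G.payPrev ι) with hθ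
  have hθ0 : 0 ≤ θ := div_nonneg (by linarith) hD.le
  have hθ1 : θ ≤ 1 := (div_le_one hD).2 (by linarith)
  have hθu : u = G.payPrev ι + θ * (G.pay ι - G.payPrev ι) := by
    rw [hθ, div_mul_cancel₀ _ hD.ne']; ring
  refine ⟨ι, κ, θ, ⟨hθ0, hθ1⟩, fun q hq ε h0 h1 => ?_⟩
  have hplus := G.le_value_equalized hικ h0 (u := G.payPrev ι + ε) (by linarith) (by linarith) hq.1
  have hminus := G.le_value_equalized hικ h0 (u := G.pay ι - ε) (by linarith) (by linarith) hq.1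
  have hmix : ∀ i, G.idealPayoff ι κ u i ≤
      (1 - θ) * (G.idealPayoff ι κ (G.payPrev ι + ε) i - ε) +
        θ * (G.idealPayoff ι κ (G.pay ι - ε) i - ε) + 2 * ε := by
    intro i
    obtain ⟨a, b, hb, hab⟩ := G.idealPayoff_affine ι κ i
    simp only [hab]
    -- Moving both endpoints inwards by `ε` shifts the mixed utility by `(1 - 2 θ) ε`, which costs
    -- at most `ε`; the equalization slack costs the other `ε`.
    have hs : |b * (2 * θ - 1)| ≤ 1 := by
      rw [abs_mul]
      exact mul_le_one₀ hb (abs_nonneg _) (abs_le.2 ⟨by linarith, by linarith⟩)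
    have := mul_le_mul_of_nonneg_right (abs_le.1 hs).2 h0.le
    rw [hθu]
    linarith
  have hsum : ∑ i, q i * G.idealPayoff ι κ u i ≤
      (1 - θ) * ∑ i, q i * (G.idealPayoff ι κ (G.payPrev ι + ε) i - ε) +
        θ * ∑ i, q i * (G.idealPayoff ι κ (G.pay ι - ε) i - ε) + 2 * ε := by
    calc _ ≤ ∑ i, q i * ((1 - θ) * (G.idealPayoff ι κ (G.payPrev ι + ε) i - ε) +
        θ * (G.idealPayoff ι κ (G.pay ι - ε) i - ε) + 2 * ε) :=
          Finset.sum_le_sum fun i _ => mul_le_mul_of_nonneg_left (hmix i) (hq.1 i)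
      _ = _ := by
          simp_rw [mul_add, Finset.sum_add_distrib, ← Finset.sum_mul, hq.2, mul_left_comm (q _),
            ← Finset.mul_sum, one_mul]
  have e1 : G.critical ι κ true ε = G.equalized (G.payPrev ι + ε) κ ε := by simp [critical]
  have e2 : G.critical ι κ false ε = G.equalized (G.pay ι - ε) κ ε := by simp [critical]
  rw [e1, e2]
  have h3 := mul_le_mul_of_nonneg_left hsum G.n_pos.le
  have h4 := mul_le_mul_of_nonneg_left hplus (sub_nonneg.2 hθ1)
  have h5 := mul_le_mul_of_nonneg_left hminus hθ0
  linarith [hval q hq.1]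

end AuditGame

/-! ### EXP3 over the templates -/

namespace AuditGame

variable {m : ℕ}

theorem exists_template_ge (G : AuditGame m) {T : ℕ} (q : Fin T → stdSimplex ℝ (Fin m))
    (p : AuditVector m) :
    ∃ c : Template m, ∑ t, G.value p (q t) ≤
      ∑ t : Fin T, (G.exp3 T).reward G t c (q t) + ∑ t : Fin T, 2 * G.n * G.slack t := by
  obtain ⟨ι, κ, θ, ⟨h0, h1⟩, h⟩ := G.exists_value_le_critical p.2
  set x := ∑ t : Fin T, (G.exp3 T).reward G t (ι, κ, true) (q t) with hx
  set y := ∑ t : Fin T, (G.exp3 T).reward G t (ι, κ, false) (q t) with hy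
  have hsum : ∑ t, G.value p (q t) ≤
      (1 - θ) * x + θ * y + ∑ t : Fin T, 2 * G.n * G.slack t := by
    rw [hx, hy, Finset.mul_sum, Finset.mul_sum, ← Finset.sum_add_distrib,
      ← Finset.sum_add_distrib]
    exact Finset.sum_le_sum fun t _ => h (q t) (q t).2 _ (G.slack_pos t) (G.slack_lt t)
  -- A convex combination of two totals is at most the larger; this needs `θ` to be the same in all
  -- rounds.
  rcases le_total x y with hxy | hxy
  · exact ⟨(ι, κ, false), hsum.trans (by rw [← hy]; nlinarith)⟩
  · exact ⟨(ι, κ, true), hsum.trans (by rw [← hx]; nlinarith)⟩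

/-- The slacks sum to at most `2 γ / 3`, and `γ ≤ B`: the shrinking slack costs a constant
independent of the horizon. -/
theorem sum_slack_le (G : AuditGame m) (T : ℕ) :
    ∑ t : Fin T, 2 * G.n * G.slack t ≤ 4 / 3 * G.normConst := by
  have hs : ∀ T : ℕ, ∑ t ∈ Finset.range T, G.slack t = 2 * (G.gap / 3) - 2 * G.slack T := by
    intro T
    induction T with
    | zero => simp [slack]
    | succ T ih => rw [Finset.sum_range_succ, ih]; unfold slack; rw [pow_succ]; field_simp; ring
  rw [← Finset.mul_sum, Fin.sum_univ_eq_sum_range (fun t => G.slack t) T, hs, normConst]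
  have h1 := mul_le_mul_of_nonneg_left G.gap_le_payoffScale G.n_pos.le
  have h2 := mul_pos G.n_pos (G.slack_pos T)
  linarith

theorem exp3_total_regret_le (G : AuditGame m) {T : ℕ} (q : Fin T → stdSimplex ℝ (Fin m))
    (c : Template m) :
    learningRate m T * (∑ t : Fin T, (G.exp3 T).reward G t c (q t) -
        (G.exp3 T).expectedTotal G q) ≤
      2 * G.normConst * (Real.log (2 * (m : ℝ) ^ 2) +
        T * (learningRate m T ^ 2 * (2 * (m : ℝ) ^ 2) / 2)) := by
  have hL := G.normConst_pos
  have hm : 0 < m := lt_of_lt_of_le (by norm_num) G.two_le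
  -- The EXP3 bound takes losses for all rounds; the prior used from round `T` on is arbitrary.
  let q' : ℕ → stdSimplex ℝ (Fin m) := fun t =>
    if h : t < T then q ⟨t, h⟩ else ⟨Pi.single ⟨0, hm⟩ 1, single_mem_stdSimplex ℝ _⟩
  have hq' : ∀ t : Fin T, q' t = q t := fun t => by simp [q']
  let v : ℕ → Template m → ℝ := fun t a => (G.exp3 T).reward G t a (q' t)
  let l : ℕ → Template m → ℝ := fun t a => (G.normConst - v t a) / (2 * G.normConst)
  -- With the priors fixed, the sampled path determines the observed utilities, so the scores are
  -- functions of the path alone.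
  let S : (t : ℕ) → (Fin t → Template m) → Template m → ℝ := fun t σ =>
    G.exp3Score T t fun r => (σ r, v r (σ r))
  have hv : ∀ t a, |v t a| ≤ G.normConst := fun t a =>
    G.abs_value_le ((G.exp3 T).play t a).2 (q' t).2
  have h0 : ∀ t a, 0 ≤ l t a := fun t a =>
    div_nonneg (by linarith [(abs_le.1 (hv t a)).2]) (by linarith)
  have h1 : ∀ t a, l t a ≤ 1 := fun t a =>
    (div_le_one (by linarith)).2 (by linarith [(abs_le.1 (hv t a)).1])
  have hS : ∀ t σ a, S (t + 1) (Fin.snoc (α := fun _ => Template m) σ a) =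
      exp3Update (learningRate m T) (S t σ) (l t a) a := by
    intro t σ a
    funext b
    simp only [S, exp3Score, exp3Update, Fin.snoc_last, Fin.snoc_castSucc, Fin.val_last,
      Fin.val_castSucc, l]
  have hmain := exp3_regret_le (η := learningRate m T) (Real.sqrt_nonneg _) h0 h1 S
    (fun _ _ => rfl) hS c T
  have hprob : ∀ σ, pathProb (fun r σ => softmax fun d => learningRate m T * S r σ d) T σ =
      (G.exp3 T).runProb G q σ := by
    intro σ
    refine Finset.prod_congr rfl fun t _ => ?_
    have htr : (fun r : Fin t => (σ (r.castLE t.2.le), v r (σ (r.castLE t.2.le)))) =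
        (G.exp3 T).transcript G q σ t := by
      funext r
      simp only [OnlineAlgorithm.transcript, v]
      rw [← hq' (r.castLE t.2.le)]
      rfl
    rw [← htr]
    rfl
  have hexp : (G.exp3 T).expectedTotal G q =
      ∑ σ, pathProb (fun r σ => softmax fun d => learningRate m T * S r σ d) T σ *
        ∑ r : Fin T, v r (σ r) := by
    unfold OnlineAlgorithm.expectedTotal
    simp only [hprob, v, hq']
  have hcmp : ∑ t : Fin T, (G.exp3 T).reward G t c (q t) = ∑ t : Fin T, v t c := by
    simp only [v, hq']
  have hone := sum_pathProb (π := fun r σ => softmax fun d => learningRate m T * S r σ d)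
    (fun _ _ => (@softmax_mem _ _ G.template_nonempty _).2) T
  have hl : ∀ t a, l t a = 1 / 2 - (2 * G.normConst)⁻¹ * v t a := fun t a => by
    simp only [l]; field_simp
  have hcard : (Fintype.card (Template m) : ℝ) = 2 * (m : ℝ) ^ 2 := by
    simp [Template]; ring
  have hconv : ∑ σ, pathProb (fun r σ => softmax fun d => learningRate m T * S r σ d) T σ *
        ∑ r : Fin T, l r (σ r) - ∑ r : Fin T, l r c =
      (2 * G.normConst)⁻¹ * (∑ t : Fin T, (G.exp3 T).reward G t c (q t) -
        (G.exp3 T).expectedTotal G q) := by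
    rw [hexp, hcmp]
    simp_rw [hl, Finset.sum_sub_distrib, mul_sub, Finset.sum_sub_distrib, ← Finset.sum_mul, hone,
      ← Finset.mul_sum, mul_left_comm _ (2 * G.normConst)⁻¹, ← Finset.mul_sum]
    ring
  rw [hconv, hcard] at hmain
  have := mul_le_mul_of_nonneg_left hmain (show 0 ≤ 2 * G.normConst by linarith)
  refine (le_of_eq ?_).trans this
  field_simp

theorem exp3_total_regret_le_sqrt (G : AuditGame m) {T : ℕ} (q : Fin T → stdSimplex ℝ (Fin m))
    (c : Template m) :
    ∑ t : Fin T, (G.exp3 T).reward G t c (q t) - (G.exp3 T).expectedTotal G q ≤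
      3 * G.normConst * √(T * (2 * (m : ℝ) ^ 2) * Real.log (2 * (m : ℝ) ^ 2)) := by
  have hm : (2 : ℝ) ≤ m := by exact_mod_cast G.two_le
  -- For `T = 0` the learning rate is `0` by the division convention and could not be cancelled.
  rcases T.eq_zero_or_pos with rfl | hT
  · simp [OnlineAlgorithm.expectedTotal]
  have hT' : (0 : ℝ) < T := by exact_mod_cast hT
  have h := G.exp3_total_regret_le q c
  set N : ℝ := 2 * (m : ℝ) ^ 2 with hN
  have hN1 : 1 < N := by nlinarith
  have hlog : 0 < Real.log N := Real.log_pos hN1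
  have hη : learningRate m T = √(Real.log N / (N * T)) := rfl
  set η := learningRate m T
  have hηpos : 0 < η := by rw [hη]; positivity
  have hη2 : η ^ 2 * (N * T) = Real.log N := by
    rw [hη, Real.sq_sqrt (by positivity)]; field_simp
  have hR : √(T * N * Real.log N) = η * (N * T) := by
    rw [← hη2, show T * N * (η ^ 2 * (N * T)) = (η * (N * T)) ^ 2 by ring,
      Real.sqrt_sq (by positivity)]
  rw [hR]
  -- Since `η² N T = log N`, the right side is `2 L (1 + 1/2) log N = η * (3 L η N T)`.
  refine le_of_mul_le_mul_left (h.trans_eq ?_) hηpos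
  rw [← hη2]
  ring

end AuditGame

/-! ### Constants and conclusion -/

/-- From `log 2 ≤ log m`, the radicand is at most `2 · 3 = 6` times `T m² log m`, and `6 ≤ 3²`. -/
theorem sqrt_template_le {m T : ℕ} (hm : 2 ≤ m) :
    √(T * (2 * (m : ℝ) ^ 2) * Real.log (2 * (m : ℝ) ^ 2)) ≤
      3 * √((T : ℝ) * (m : ℝ) ^ 2 * Real.log m) := by
  have hm' : (2 : ℝ) ≤ m := by exact_mod_cast hm
  have hlog0 : 0 ≤ Real.log m := Real.log_nonneg (by linarith)
  have hlog : Real.log (2 * (m : ℝ) ^ 2) ≤ 3 * Real.log m := by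
    rw [Real.log_mul (by norm_num) (by positivity), Real.log_pow]
    have := Real.log_le_log (by norm_num) hm'
    push_cast
    linarith
  have h9 : (3 : ℝ) = √9 := by
    rw [show (9 : ℝ) = 3 ^ 2 by norm_num, Real.sqrt_sq (by norm_num)]
  rw [h9, ← Real.sqrt_mul (by norm_num)]
  refine Real.sqrt_le_sqrt ?_
  have h1 : 0 ≤ (T : ℝ) * (m : ℝ) ^ 2 := by positivity
  have := mul_le_mul_of_nonneg_left hlog h1
  nlinarith [mul_nonneg h1 hlog0]

/-- Lets the constant slack loss be absorbed into the main term. -/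
theorem one_le_sqrt_horizon {m T : ℕ} (hm : 2 ≤ m) (hT : 0 < T) :
    1 ≤ √((T : ℝ) * (m : ℝ) ^ 2 * Real.log m) := by
  have hm' : (2 : ℝ) ≤ m := by exact_mod_cast hm
  have hT' : (1 : ℝ) ≤ T := by exact_mod_cast hT
  have hlog : 1 / 2 ≤ Real.log m := by
    have := Real.log_le_log (by norm_num) hm'
    linarith [Real.log_two_gt_d9]
  rw [Real.one_le_sqrt]
  have h4 : (4 : ℝ) ≤ T * (m : ℝ) ^ 2 := by nlinarith
  nlinarith

/-- The constant collects `3 · 3` from EXP3 and `4/3` from the slacks: `9 + 4/3 ≤ 11`. -/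
theorem AuditGame.value_sum_le {m T : ℕ} (G : AuditGame m) (q : Fin T → stdSimplex ℝ (Fin m))
    (p : AuditVector m) :
    ∑ t, G.value p (q t) ≤ 11 * G.payoffScale *
      (G.n * √((T : ℝ) * (m : ℝ) ^ 2 * Real.log (m : ℝ))) + (G.exp3 T).expectedTotal G q := by
  rcases T.eq_zero_or_pos with rfl | hT
  · simp [OnlineAlgorithm.expectedTotal]
  obtain ⟨c, hc⟩ := G.exists_template_ge q p
  have h1 := G.exp3_total_regret_le_sqrt q c
  have h2 := G.sum_slack_le T
  have hL := G.normConst_pos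
  have h3 := mul_le_mul_of_nonneg_left (sqrt_template_le (T := T) G.two_le)
    (show 0 ≤ 3 * G.normConst by linarith)
  have h4 := mul_le_mul_of_nonneg_left (one_le_sqrt_horizon G.two_le hT) hL.le
  have h5 : 11 * G.payoffScale * (G.n * √((T : ℝ) * (m : ℝ) ^ 2 * Real.log (m : ℝ))) =
      11 * (G.normConst * √((T : ℝ) * (m : ℝ) ^ 2 * Real.log (m : ℝ))) := by
    rw [AuditGame.normConst]; ring
  rw [h5]
  linarith

theorem theorem3 :
    ∃ C : ℝ, ∀ (m : ℕ) (G : AuditGame m) (T : ℕ),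
      (G.exp3 T).regret G T ≤
        ((C * G.payoffScale * (G.n * √((T : ℝ) * (m : ℝ) ^ 2 * Real.log (m : ℝ))) : ℝ) :
          EReal) := by
  refine ⟨11, fun m G T => iSup_le fun q => ?_⟩
  refine EReal.sub_le_of_le_add (iSup_le fun p => ?_)
  rw [← EReal.coe_add, EReal.coe_le_coe_iff]
  exact G.value_sum_le q p
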